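/- Let $\{0,1\}^{\mathbb N}$ be Cantor space. Fix a computable bijective coding $\langle\cdot,\cdot\rangle$ of pairs of numbers and an injective computable coding of finite binary words by numbers. A name of an open set $U\subseteq\{0,1\}^{\mathbb N}$ is an $r\in\{0,1\}^{\mathbb N}$ such that $U$ is the union of the cylinders $[w]$ over all words $w$ with $r(\langle w,t\rangle)=1$ for some $t\in\mathbb N$ (so $r$ enumerates words whose cylinders exhaust $U$). A name of a $\Delta^0_2$ set $D$ is a sequence of names of open sets $V_0,U_0,V_1,U_1,\dots$, coded as one element of $\{0,1\}^{\mathbb N}$, such that, with the closed sets $A_i:=\{0,1\}^{\mathbb N}\setminus V_i$, $D=\bigcup_{i\in\mathbb N}A_i=\bigcap_{i\in\mathbb N}U_i$. A set is computably open (computably $\Delta^0_2$) if it has a computable name, and the number of a program that computes such a name is an index of the set. A function $f:\{0,1\}^{\mathbb N}\to\{0,1\}^{\mathbb N}$ is called - *Markov-effectively $\Delta^0_2$-measurable* if there is a partial computable function $P:\subseteq\mathbb N\to\mathbb N$ such that, whenever $n$ is an index of a computably open set $U$, $P(n)$ is defined and is an index of $f^{-1}(U)$ as a computably $\Delta^0_2$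 set; - *effectively $\Delta^0_2$-measurable* if some (type-2) computable map sends every name of an arbitrary open set $U$ to a name of the $\Delta^0_2$ set $f^{-1}(U)$; - *piecewise continuous* if $\{0,1\}^{\mathbb N}$ is covered by countably many closed sets such that the restriction of $f$ to each of them is continuous. Then: (1) there is a Markov-effectively $\Delta^0_2$-measurable function $f:\{0,1\}^{\mathbb N}\to\{0,1\}^{\mathbb N}$ that is not piecewise continuous; (2) Markov-effective $\Delta^0_2$-measurability does not imply effective $\Delta^0_2$-measurability, i.e. there is a Markov-effectively $\Delta^0_2$-measurable function $f:\{0,1\}^{\mathbb N}\to\{0,1\}^{\mathbb N}$ that is not effectively $\Delta^0_2$-measurable. -/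

import Mathlib

namespace Delta2

/-- Cantor space `{0,1}^ℕ`, with the product topology. Its points also serve as names. -/
abbrev Cantor : Type := ℕ → Bool

/-- The prefix of length `n` of `p`. -/
def pre (p : Cantor) (n : ℕ) : List Bool := (List.range n).map p

/-- The open set named by `r`: the union of the cylinders `[w]` over all words `w` listed by `r`,
where `r` lists `w` if `r ⟨w, t⟩ = 1` for some `t`. Every `r` is a name. -/
def openOf (r : Cantor) : Set Cantor :=
  {p | ∃ n t : ℕ, r (Nat.pair (Encodable.encode (pre p n)) t) = true}

/-- The `k`-th component of the sequence of names coded by `s`. -/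
def row (s : Cantor) (k : ℕ) : Cantor := fun j => s (Nat.pair k j)

/-- `s` is a name of the `Δ⁰₂` set `D`: it codes a sequence `(A i, U i)` of closed sets `A i`
(given by names of their complements) and open sets `U i` with `D = ⋃ i, A i = ⋂ i, U i`. -/
def IsDelta2Name (s : Cantor) (D : Set Cantor) : Prop :=
  D = ⋃ i : ℕ, (openOf (row s (2 * i)))ᶜ ∧ D = ⋂ i : ℕ, openOf (row s (2 * i + 1))

/-- The `n`-th partial computable function is total and computes the name `r`. -/
def IsNameIndex (n : ℕ) (r : Cantor) : Prop :=
  ∀ k : ℕ, Encodable.encode (r k) ∈ (Denumerable.ofNat Nat.Partrec.Code n).eval k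

/-- The partial enumeration of the computably open sets: `n` is an index of `U`. -/
def IsOpenIndex (n : ℕ) (U : Set Cantor) : Prop :=
  ∃ r : Cantor, IsNameIndex n r ∧ openOf r = U

/-- The partial enumeration of the computably `Δ⁰₂` sets: `n` is an index of `D`. -/
def IsDelta2Index (n : ℕ) (D : Set Cantor) : Prop :=
  ∃ s : Cantor, IsNameIndex n s ∧ IsDelta2Name s D

/-- `f` is Markov-effectively `Δ⁰₂`-measurable: a partial computable function on indices turns
every index of a computably open set `U` into an index of the `Δ⁰₂` set `f⁻¹(U)`. -/
def MarkovEffectivelyDelta2Measurable (f : Cantor → Cantor) : Prop :=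
  ∃ P : ℕ →. ℕ, Nat.Partrec P ∧
    ∀ (n : ℕ) (U : Set Cantor), IsOpenIndex n U → ∃ m ∈ P n, IsDelta2Index m (f ⁻¹' U)

/-- A total function on Cantor space is (type-2) computable if its finite output prefixes are
produced, from finite input prefixes, by a computable monotone function on words. -/
def Type2Computable (F : Cantor → Cantor) : Prop :=
  ∃ h : List Bool → List Bool, Computable h ∧
    (∀ u v : List Bool, u <+: v → h u <+: h v) ∧
    ∀ p : Cantor,
      (∀ n : ℕ, h (pre p n) = pre (F p) (h (pre p n)).length) ∧
      ∀ m : ℕ, ∃ n : ℕ, m ≤ (h (pre p n)).length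

/-- `f` is effectively `Δ⁰₂`-measurable: `U ↦ f⁻¹(U)`, from open sets to `Δ⁰₂` sets, has a
computable realizer (every point of Cantor space is a name of an open set). -/
def EffectivelyDelta2Measurable (f : Cantor → Cantor) : Prop :=
  ∃ F : Cantor → Cantor, Type2Computable F ∧
    ∀ r : Cantor, IsDelta2Name (F r) (f ⁻¹' openOf r)

/-- `f` is piecewise continuous: the domain has a countable cover by closed sets on each of which
the restriction of `f` is continuous. -/
def PiecewiseContinuous (f : Cantor → Cantor) : Prop :=
  ∃ A : ℕ → Set Cantor, (∀ i, IsClosed (A i)) ∧ (⋃ i, A i) = Set.univ ∧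
    ∀ i, ContinuousOn f (A i)

end Delta2

open Nat.Partrec (Code)
open Filter Topology

namespace Delta2

/-! One function, `countOnes`, serves both claims. It sends a point with exactly `c` ones to `point
c` and any other point to `limitPoint`. The words `stem n n` follow a limit construction of a
generic point: for each `e`, a fixed word that decides the `e`-th enumerated open set is a prefix of
almost all of them (`exists_stable_decides`). Hence along every `p` the computable `guess` converges
to the truth about `countOnes p ∈ U`, for any computably open `U` (`eventually_guess_iff`), and such
a limit yields a `Δ⁰₂` name uniformly in the index.

The fibre of `limitPoint` contains the dense `G_δ` of points with infinitely many ones, while its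
complement is dense. By Baire it is not `F_σ`, which both piecewise continuity and effective
measurability would force. -/

/-- By stage `s`, the `e`-th program has enumerated some prefix of the word `w`. -/
def Listed (e s : ℕ) (w : List Bool) : Prop :=
  ∃ x < s, Code.evaln s (Denumerable.ofNat Code e)
    (Nat.pair (Encodable.encode (w.take x.unpair.1)) x.unpair.2) = some 1

instance (e s : ℕ) (w : List Bool) : Decidable (Listed e s w) := by
  unfold Listed; infer_instance

/-- The word with a given code number. -/
def wordOf (v : ℕ) : List Bool := (Encodable.decode v).getD []

/-- Extend `σ` to a word enumerated by the `e`-th program, if one is found by stage `s`. -/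
def extendStem (e s : ℕ) (σ : List Bool) : List Bool :=
  let w := σ ++ wordOf ((List.range s).findIdx fun v => decide (Listed e s (σ ++ wordOf v)))
  -- A failed `findIdx` returns `s`, so the candidate has to be tested again.
  if Listed e s w then w else σ

/-- The stage `s` approximation of a word that decides the first `e` enumerated open sets. -/
def stem (s e : ℕ) : List Bool := Nat.rec [] (fun i σ => extendStem i s σ) e

/-- A computable sequence of computable points, with consecutive points different. -/
def point (n : ℕ) : Cantor := fun k => (stem n n).getD k n.bodd

/-- The number of ones in a word. -/
def ones (w : List Bool) : ℕ := w.foldl (fun c b => c + b.toNat) 0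

/-- The approximation, computed from a prefix `w` of `p`, to whether the image of `p` belongs to the
`e`-th open set. -/
def guess (e : ℕ) (w : List Bool) : Bool :=
  decide (Listed e w.length (pre (point (ones w)) w.length))

/-! ### Primitive recursiveness of the construction -/

theorem primrec_listed :
    Primrec fun a : (ℕ × ℕ) × List Bool => decide (Listed a.1.1 a.1.2 a.2) := by
  have h : PrimrecRel fun (x : ℕ) (a : (ℕ × ℕ) × List Bool) =>
      Code.evaln a.1.2 (Denumerable.ofNat Code a.1.1)
        (Nat.pair (Encodable.encode (a.2.take x.unpair.1)) x.unpair.2) = some 1 := by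
    refine Primrec.eq.comp (Code.primrec_evaln.comp (Primrec.pair (Primrec.pair ?_ ?_) ?_))
      (Primrec.const _)
    · exact Primrec.snd.comp (Primrec.fst.comp Primrec.snd)
    · exact (Primrec.ofNat Code).comp (Primrec.fst.comp (Primrec.fst.comp Primrec.snd))
    · exact Primrec₂.natPair.comp
        (Primrec.encode.comp (Primrec.list_take.comp
          (Primrec.fst.comp (Primrec.unpair.comp Primrec.fst)) (Primrec.snd.comp Primrec.snd)))
        (Primrec.snd.comp (Primrec.unpair.comp Primrec.fst))
  have hr := h.exists_mem_list
  have hp : PrimrecPred fun a : (ℕ × ℕ) × List Bool => Listed a.1.1 a.1.2 a.2 :=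
    (PrimrecRel.comp hr (Primrec.list_range.comp (Primrec.snd.comp Primrec.fst))
      Primrec.id).of_eq fun a => by simp [Listed]
  exact hp.decide

theorem primrec_wordOf : Primrec wordOf :=
  Primrec.option_getD.comp Primrec.decode (Primrec.const [])

theorem primrec_extendStem :
    Primrec fun a : (ℕ × ℕ) × List Bool => extendStem a.1.1 a.1.2 a.2 := by
  have hw : Primrec fun a : (ℕ × ℕ) × List Bool =>
      a.2 ++ wordOf ((List.range a.1.2).findIdx fun v =>
        decide (Listed a.1.1 a.1.2 (a.2 ++ wordOf v))) := by
    refine Primrec.list_append.comp Primrec.snd (primrec_wordOf.comp (Primrec.list_findIdx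
      (Primrec.list_range.comp (Primrec.snd.comp Primrec.fst)) ?_))
    exact primrec_listed.comp (Primrec.pair (Primrec.fst.comp Primrec.fst)
      (Primrec.list_append.comp (Primrec.snd.comp Primrec.fst)
        (primrec_wordOf.comp Primrec.snd)))
  refine Primrec.ite ⟨inferInstance, ?_⟩ hw Primrec.snd
  exact primrec_listed.comp (Primrec.pair Primrec.fst hw)

theorem primrec_stem : Primrec₂ stem := by
  refine Primrec.nat_rec' (f := fun a : ℕ × ℕ => a.2) (g := fun _ => ([] : List Bool))
    (h := fun a p => extendStem p.1 a.1 p.2) Primrec.snd (Primrec.const _) ?_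
  exact primrec_extendStem.comp (Primrec.pair (Primrec.pair
    (Primrec.fst.comp Primrec.snd) (Primrec.fst.comp Primrec.fst))
    (Primrec.snd.comp Primrec.snd))

theorem primrec_point : Primrec₂ point := by
  have h : Primrec fun a : ℕ × ℕ => ((stem a.1 a.1)[a.2]?).getD a.1.bodd :=
    Primrec.option_getD.comp (Primrec.list_getElem?.comp
      (primrec_stem.comp Primrec.fst Primrec.fst) Primrec.snd)
      (Primrec.nat_bodd.comp Primrec.fst)
  exact h.of_eq fun a => by simp [point]

theorem primrec_ones : Primrec ones := by
  refine Primrec.list_foldl (h := fun _ (a : ℕ × Bool) => a.1 + a.2.toNat) Primrec.id (Primrec.const 0) ?_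
  exact Primrec.nat_add.comp (Primrec.fst.comp Primrec.snd)
    ((Primrec.dom_finite Bool.toNat).comp (Primrec.snd.comp Primrec.snd))

theorem primrec_guess : Primrec₂ guess := by
  have hl : Primrec fun a : ℕ × List Bool => a.2.length := Primrec.list_length.comp Primrec.snd
  refine primrec_listed.comp (Primrec.pair (Primrec.pair Primrec.fst hl) ?_)
  exact Primrec.list_map (Primrec.list_range.comp hl)
    (primrec_point.comp (primrec_ones.comp (Primrec.snd.comp Primrec.fst)) Primrec.snd)

/-! ### Names of `Δ⁰₂` sets from convergent guesses -/

/-- The name of the `Δ⁰₂` set with characteristic function `lim guess e (pre p n)`. -/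
def limitName (e : ℕ) : Cantor := fun j =>
  decide (j.unpair.1 / 2 ≤ (wordOf j.unpair.2.unpair.1).length) &&
    (j.unpair.1.bodd == guess e (wordOf j.unpair.2.unpair.1))

theorem primrec_limitName : Primrec₂ limitName := by
  have hk : Primrec fun a : ℕ × ℕ => a.2.unpair.1 :=
    Primrec.fst.comp (Primrec.unpair.comp Primrec.snd)
  have hw : Primrec fun a : ℕ × ℕ => wordOf a.2.unpair.2.unpair.1 :=
    primrec_wordOf.comp (Primrec.fst.comp (Primrec.unpair.comp
      (Primrec.snd.comp (Primrec.unpair.comp Primrec.snd))))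
  refine Primrec.and.comp ?_ (Primrec.beq.comp (Primrec.nat_bodd.comp hk)
    (primrec_guess.comp Primrec.fst hw))
  exact (Primrec.nat_le.comp (Primrec.nat_div2.comp hk) (Primrec.list_length.comp hw)).decide.of_eq
    fun a => by
      simp only [Nat.div2_val]; congr

theorem wordOf_encode (w : List Bool) : wordOf (Encodable.encode w) = w := by
  simp [wordOf]

theorem length_pre (p : Cantor) (n : ℕ) : (pre p n).length = n := by simp [pre]

theorem mem_openOf_limitName_even {e i : ℕ} {p : Cantor} :
    p ∈ openOf (row (limitName e) (2 * i)) ↔ ∃ n ≥ i, guess e (pre p n) = false := by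
  simp [openOf, row, limitName, wordOf_encode, length_pre]

theorem mem_openOf_limitName_odd {e i : ℕ} {p : Cantor} :
    p ∈ openOf (row (limitName e) (2 * i + 1)) ↔ ∃ n ≥ i, guess e (pre p n) = true := by
  have : (2 * i + 1) / 2 = i := by omega
  simp [openOf, row, limitName, wordOf_encode, length_pre, this]

/-- For a convergent guess, "true from `i` on, for some `i`" and "true infinitely often" agree; the
first is a union of closed sets, the second an intersection of open ones. -/
theorem isDelta2Name_limitName {e : ℕ} {D : Set Cantor}
    (h : ∀ p, ∀ᶠ n in atTop, guess e (pre p n) = true ↔ p ∈ D) :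
    IsDelta2Name (limitName e) D := by
  constructor
  · ext p
    obtain ⟨N, hN⟩ := eventually_atTop.1 (h p)
    simp only [Set.mem_iUnion, Set.mem_compl_iff, mem_openOf_limitName_even, not_exists, not_and,
      Bool.not_eq_false]
    refine ⟨fun hp => ⟨N, fun n hn => (hN n hn).2 hp⟩, fun ⟨i, hi⟩ => ?_⟩
    exact (hN (max N i) (le_max_left _ _)).1 (hi _ (le_max_right _ _))
  · ext p
    obtain ⟨N, hN⟩ := eventually_atTop.1 (h p)
    simp only [Set.mem_iInter, mem_openOf_limitName_odd]
    refine ⟨fun hp i => ⟨max N i, le_max_right _ _, (hN _ (le_max_left _ _)).2 hp⟩, fun hp => ?_⟩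
    obtain ⟨n, hn, hg⟩ := hp N
    exact (hN n hn).1 hg

theorem exists_computable_index_limitName :
    ∃ P : ℕ → ℕ, Computable P ∧ ∀ e, IsNameIndex (P e) (limitName e) := by
  have hc : Nat.Partrec (fun x : ℕ => Part.some
      (Encodable.encode (limitName x.unpair.1 x.unpair.2))) := by
    refine Partrec.nat_iff.1 (Computable.partrec (Primrec.to_comp ?_))
    exact Primrec.encode.comp (primrec_limitName.comp (Primrec.fst.comp Primrec.unpair)
      (Primrec.snd.comp Primrec.unpair))
  obtain ⟨c, hc⟩ := Code.exists_code.1 hc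
  refine ⟨fun e => Encodable.encode (Code.curry c e),
    (Primrec.encode.comp (Code.primrec₂_curry.comp (Primrec.const c) Primrec.id)).to_comp,
    fun e k => ?_⟩
  simp [Code.eval_curry, hc]

/-! ### Convergence of the stems -/

theorem Listed.mono {e s t : ℕ} {v w : List Bool} (h : Listed e s v) (hst : s ≤ t)
    (hvw : v <+: w) : Listed e t w := by
  obtain ⟨x, hx, h⟩ := h
  obtain ⟨u, rfl⟩ := hvw
  have key : v.take x.unpair.1 = (v ++ u).take (min x.unpair.1 v.length) := by
    rw [List.take_append_of_le_length (min_le_right _ _), List.take_eq_take_min]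
  refine ⟨Nat.pair (min x.unpair.1 v.length) x.unpair.2, ?_, ?_⟩
  · refine lt_of_le_of_lt ?_ (hx.trans_le hst)
    rcases min_le_left x.unpair.1 v.length |>.eq_or_lt with h | h
    · rw [h, Nat.pair_unpair]
    · exact (Nat.pair_lt_pair_left _ h).le.trans_eq (Nat.pair_unpair x)
  · rw [Nat.unpair_pair]
    simp only [← key]
    exact Code.evaln_mono hst h

theorem pre_prefix_pre (p : Cantor) {m n : ℕ} (h : m ≤ n) : pre p m <+: pre p n := by
  obtain ⟨k, rfl⟩ := Nat.exists_eq_add_of_le h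
  simp [pre, List.range_add]

theorem take_pre (p : Cantor) (m n : ℕ) : (pre p n).take m = pre p (min m n) := by
  simp [pre, ← List.map_take, List.take_range]

theorem mem_openOf_iff_exists_listed {e : ℕ} {r : Cantor} (h : IsNameIndex e r) (p : Cantor) :
    p ∈ openOf r ↔ ∃ s m, Listed e s (pre p m) := by
  constructor
  · rintro ⟨n, t, hr⟩
    have h1 := h (Nat.pair (Encodable.encode (pre p n)) t)
    rw [hr] at h1
    obtain ⟨k, hk⟩ := Code.evaln_complete.1 h1
    refine ⟨max k (Nat.pair n t + 1), n, Nat.pair n t, by omega, ?_⟩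
    rw [Nat.unpair_pair, take_pre]
    simp only [min_self]
    exact Code.evaln_mono (le_max_left _ _) hk
  · rintro ⟨s, m, x, -, hx⟩
    have h1 := Code.evaln_sound hx
    rw [take_pre] at h1
    have h2 := Part.mem_unique (h _) h1
    refine ⟨min x.unpair.1 m, x.unpair.2, ?_⟩
    generalize r _ = b at h2 ⊢
    revert h2; cases b <;> simp

theorem prefix_extendStem (e s : ℕ) (σ : List Bool) : σ <+: extendStem e s σ := by
  unfold extendStem
  dsimp only
  split_ifs
  · exact List.prefix_append _ _
  · exact List.prefix_rfl

theorem stem_prefix_stem (s : ℕ) {d e : ℕ} (h : d ≤ e) : stem s d <+: stem s e := by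
  induction e, h using Nat.le_induction with
  | base => exact List.prefix_rfl
  | succ e _ ih => exact ih.trans (prefix_extendStem e s _)

/-- A word decides the `e`-th enumerated open set if its cylinder is contained in it or disjoint
from it. -/
def Decides (e : ℕ) (τ : List Bool) : Prop :=
  (∃ s, Listed e s τ) ∨ ∀ s v, τ <+: v → ¬ Listed e s v

/-- If some extension is ever listed, the search eventually settles on the one of least code;
otherwise `σ` itself is never extended. -/
theorem exists_eventually_extendStem_eq (e : ℕ) (σ : List Bool) :
    ∃ τ, (∀ᶠ s in atTop, extendStem e s σ = τ) ∧ Decides e τ := by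
  classical
  by_cases h : ∃ v s, Listed e s (σ ++ wordOf v)
  · obtain ⟨s, hs⟩ := Nat.find_spec h
    refine ⟨σ ++ wordOf (Nat.find h), ?_, Or.inl ⟨s, hs⟩⟩
    filter_upwards [eventually_ge_atTop s, eventually_gt_atTop (Nat.find h)] with t ht hv
    have hl : Listed e t (σ ++ wordOf (Nat.find h)) := hs.mono ht List.prefix_rfl
    have hi : ((List.range t).findIdx fun v => decide (Listed e t (σ ++ wordOf v)))
        = Nat.find h := by
      rw [List.findIdx_eq (by simpa using hv)]
      refine ⟨by simpa using hl, fun j hj => ?_⟩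
      have := Nat.find_min h hj
      simp only [not_exists] at this
      simpa using this t
    simp only [extendStem, hi, if_pos hl]
  · push Not at h
    refine ⟨σ, .of_forall fun s => by simp only [extendStem, if_neg (h _ s)], Or.inr ?_⟩
    rintro s _ ⟨v, rfl⟩ hl
    exact h (Encodable.encode v) s (by rwa [wordOf_encode])

theorem exists_eventually_stem_eq (e : ℕ) : ∃ τ, ∀ᶠ s in atTop, stem s e = τ := by
  induction e with
  | zero => exact ⟨[], .of_forall fun _ => rfl⟩
  | succ e ih =>
    obtain ⟨σ, hσ⟩ := ih
    obtain ⟨τ, hτ, -⟩ := exists_eventually_extendStem_eq e σ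
    refine ⟨τ, ?_⟩
    filter_upwards [hσ, hτ] with s h1 h2
    rw [← h2, ← h1]; rfl

/-- `τ` is a prefix of almost all of the words `stem n n`. -/
def Stable (τ : List Bool) : Prop := ∀ᶠ n in atTop, τ <+: stem n n

theorem exists_stable_decides (e : ℕ) : ∃ τ, Stable τ ∧ Decides e τ := by
  obtain ⟨σ, hσ⟩ := exists_eventually_stem_eq e
  obtain ⟨τ, hτ, hd⟩ := exists_eventually_extendStem_eq e σ
  refine ⟨τ, ?_, hd⟩
  filter_upwards [hσ, hτ, eventually_ge_atTop (e + 1)] with s h1 h2 hs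
  rw [← h2, ← h1]
  exact stem_prefix_stem s hs

open Classical in
/-- The point all of whose neighbourhoods given by stable words contain almost all `point n`. -/
noncomputable def limitPoint : Cantor := fun k => decide (∃ τ, Stable τ ∧ τ[k]? = some true)

/-- Two stable words are prefixes of a common stem, so they agree wherever both are defined. -/
theorem Stable.eq_pre_limitPoint {τ : List Bool} (h : Stable τ) :
    τ = pre limitPoint τ.length := by
  refine List.ext_getElem (by simp [pre]) fun k hk _ => ?_
  have hp : ∀ h, (pre limitPoint τ.length)[k]'h = limitPoint k := fun _ => by simp [pre]
  classical
  rw [hp, limitPoint]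
  cases hb : τ[k] with
  | true => exact (decide_eq_true ⟨τ, h, by simp [hk, hb]⟩).symm
  | false =>
    refine (decide_eq_false ?_).symm
    rintro ⟨σ, hσ, hs⟩
    obtain ⟨n, h1, h2⟩ := (h.and hσ).exists
    obtain ⟨hkσ, hs⟩ := List.getElem?_eq_some_iff.1 hs
    have e1 := h1.getElem hk
    have e2 := h2.getElem hkσ
    rw [hb] at e1
    rw [hs, ← e1] at e2
    simp at e2

theorem prefix_pre_point {τ : List Bool} {n t : ℕ} (h : τ <+: stem n n) (ht : τ.length ≤ t) :
    τ <+: pre (point n) t := by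
  refine List.IsPrefix.trans ?_ (pre_prefix_pre _ ht)
  suffices τ = pre (point n) τ.length by rw [← this]
  refine List.ext_getElem (by simp [pre]) fun k hk _ => ?_
  have := h.length_le
  rw [h.getElem hk]
  simp [pre, point, List.getElem?_eq_getElem (hk.trans_le this)]

/-- Beyond both stems the points are padded with bits of opposite parity. -/
theorem point_ne_point_succ (n : ℕ) : point n ≠ point (n + 1) := by
  intro h
  have := congrFun h ((stem n n).length + (stem (n + 1) (n + 1)).length)
  simp [point] at this

/-! ### The function and its Markov-effective measurability -/

theorem ones_pre_succ (p : Cantor) (n : ℕ) : ones (pre p (n + 1)) = ones (pre p n) + (p n).toNat := by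
  simp [ones, pre, List.range_succ]

theorem monotone_ones_pre (p : Cantor) : Monotone fun n => ones (pre p n) :=
  monotone_nat_of_le_succ fun n => by simp [ones_pre_succ]

open Classical in
/-- A point with exactly `c` ones goes to `point c`, one with infinitely many to `limitPoint`. -/
noncomputable def countOnes (p : Cantor) : Cantor :=
  if h : ∃ c, ∀ᶠ n in atTop, ones (pre p n) = c then point h.choose else limitPoint

theorem countOnes_eq_point {p : Cantor} {c : ℕ} (h : ∀ᶠ n in atTop, ones (pre p n) = c) :
    countOnes p = point c := by
  have h' : ∃ c, ∀ᶠ n in atTop, ones (pre p n) = c := ⟨c, h⟩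
  obtain ⟨n, h1, h2⟩ := (h'.choose_spec.and h).exists
  rw [countOnes, dif_pos h', ← h1, h2]

theorem countOnes_eq_limitPoint {p : Cantor} (h : Tendsto (fun n => ones (pre p n)) atTop atTop) :
    countOnes p = limitPoint := by
  rw [countOnes, dif_neg]
  rintro ⟨c, hc⟩
  obtain ⟨n, h1, h2⟩ := (hc.and (h.eventually_gt_atTop c)).exists
  omega

/-- With infinitely many ones, a stable deciding word is a prefix of almost all points consulted: it
is listed by a stage independent of `n`, or no extension ever is. Otherwise the point consulted is
eventually fixed. -/
theorem eventually_guess_iff {e : ℕ} {r : Cantor} (h : IsNameIndex e r) (p : Cantor) :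
    ∀ᶠ n in atTop, guess e (pre p n) = true ↔ countOnes p ∈ openOf r := by
  simp only [guess, decide_eq_true_eq, length_pre]
  rw [mem_openOf_iff_exists_listed h]
  rcases tendsto_atTop_of_monotone (monotone_ones_pre p) with ht | ⟨c, hc⟩
  · rw [countOnes_eq_limitPoint ht]
    obtain ⟨τ, hτ, hd⟩ := exists_stable_decides e
    have hpre : ∀ᶠ n in atTop, τ <+: pre (point (ones (pre p n))) n := by
      filter_upwards [ht.eventually hτ, eventually_ge_atTop τ.length] with n h1 h2
      exact prefix_pre_point h1 h2
    rcases hd with ⟨s, hs⟩ | hd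
    · filter_upwards [hpre, eventually_ge_atTop s] with n h1 h2
      refine iff_of_true (hs.mono h2 h1) ⟨s, τ.length, ?_⟩
      rwa [← hτ.eq_pre_limitPoint]
    · filter_upwards [hpre] with n h1
      refine iff_of_false (hd _ _ h1) ?_
      rintro ⟨s, m, hs⟩
      refine hd s (pre limitPoint (max m τ.length)) ?_
        (hs.mono le_rfl (pre_prefix_pre _ (le_max_left _ _)))
      conv_lhs => rw [hτ.eq_pre_limitPoint]
      exact pre_prefix_pre _ (le_max_right _ _)
  · rw [nhds_discrete, tendsto_pure] at hc
    rw [countOnes_eq_point hc]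
    by_cases hp : ∃ s m, Listed e s (pre (point c) m)
    · obtain ⟨s, m, hs⟩ := hp
      filter_upwards [hc, eventually_ge_atTop s, eventually_ge_atTop m] with n h1 h2 h3
      rw [h1]
      exact iff_of_true (hs.mono h2 (pre_prefix_pre _ h3)) ⟨s, m, hs⟩
    · filter_upwards [hc] with n h1
      rw [h1]
      exact iff_of_false (fun h => hp ⟨_, _, h⟩) hp

theorem markovEffectivelyDelta2Measurable_countOnes :
    MarkovEffectivelyDelta2Measurable countOnes := by
  obtain ⟨P, hP, hidx⟩ := exists_computable_index_limitName
  refine ⟨P, Partrec.nat_iff.1 hP.partrec, ?_⟩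
  rintro e _ ⟨r, hr, rfl⟩
  exact ⟨P e, Part.mem_some _, _, hidx e, isDelta2Name_limitName (eventually_guess_iff hr)⟩

/-! ### Baire category and the two negative results -/

theorem dense_of_exists_prefix {S : Set Cantor}
    (h : ∀ (p : Cantor) (n : ℕ), ∃ q ∈ S, ∀ k < n, q k = p k) : Dense S := by
  intro p
  choose q hq hqp using h p
  refine mem_closure_of_tendsto (f := q) (b := atTop) ?_ (.of_forall hq)
  refine tendsto_pi_nhds.2 fun k => tendsto_const_nhds.congr' ?_
  filter_upwards [eventually_gt_atTop k] with n hn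
  exact (hqp n k hn).symm

theorem pre_congr {p q : Cantor} {n : ℕ} (h : ∀ k < n, p k = q k) : pre p n = pre q n :=
  List.map_congr_left fun k hk => h k (List.mem_range.1 hk)

theorem countOnes_of_eventually_false {p : Cantor} {N : ℕ} (h : ∀ k ≥ N, p k = false) :
    countOnes p = point (ones (pre p N)) := by
  refine countOnes_eq_point ?_
  filter_upwards [eventually_ge_atTop N] with n hn
  induction n, hn using Nat.le_induction with
  | base => rfl
  | succ n hn ih => rw [ones_pre_succ, ih, h n hn]; rfl

theorem dense_countOnes_ne : Dense {p | countOnes p ≠ limitPoint} := by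
  refine dense_of_exists_prefix fun p n => ?_
  -- The two continuations have consecutive counts of ones, hence different images, so one of them
  -- misses `limitPoint`.
  let q : Bool → Cantor := fun b k => if k < n then p k else if k = n then b else false
  have hq : ∀ b, countOnes (q b) = point (ones (pre p n) + b.toNat) := fun b => by
    rw [countOnes_of_eventually_false (N := n + 1) (fun k hk => ?_), ones_pre_succ,
      pre_congr (q := p) (fun k hk => by simp [q, hk])]
    · simp [q]
    · simp [q, show ¬ k < n by omega, show k ≠ n by omega]
  by_cases h : countOnes (q false) = limitPoint
  · refine ⟨q true, fun h' => ?_, fun k hk => by simp [q, hk]⟩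
    rw [hq] at h h'
    exact point_ne_point_succ _ (h.trans h'.symm)
  · exact ⟨q false, h, fun k hk => by simp [q, hk]⟩

theorem isOpen_setOf_apply_eq (k : ℕ) (b : Bool) : IsOpen {p : Cantor | p k = b} :=
  (isOpen_discrete {b}).preimage (continuous_apply (A := fun _ : ℕ => Bool) k)

theorem countOnes_eq_limitPoint_of_frequently {p : Cantor} (h : ∀ n, ∃ k ≥ n, p k = true) :
    countOnes p = limitPoint := by
  refine countOnes_eq_limitPoint
    ((tendsto_atTop_of_monotone (monotone_ones_pre p)).resolve_right ?_)
  rintro ⟨c, hc⟩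
  rw [nhds_discrete, tendsto_pure, eventually_atTop] at hc
  obtain ⟨N, hN⟩ := hc
  obtain ⟨k, hk, hp⟩ := h N
  have h1 := hN (k + 1) (by omega)
  rw [ones_pre_succ, hN k hk, hp] at h1
  simp at h1

/-- The fibre of `limitPoint` is not an `F_σ` set. -/
theorem countOnes_fibre_ne_iUnion_isClosed (B : ℕ → Set Cantor) (hB : ∀ i, IsClosed (B i)) :
    countOnes ⁻¹' {limitPoint} ≠ ⋃ i, B i := by
  intro h
  have h1 : {p | countOnes p ≠ limitPoint} = ⋂ i, (B i)ᶜ := by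
    rw [← Set.compl_iUnion, ← h]; rfl
  have g1 : IsGδ {p | countOnes p ≠ limitPoint} := by
    rw [h1]; exact .iInter_of_isOpen fun i => (hB i).isOpen_compl
  have g2 : IsGδ {p : Cantor | ∀ n, ∃ k ≥ n, p k = true} := by
    have : {p : Cantor | ∀ n, ∃ k ≥ n, p k = true} = ⋂ n, ⋃ k ≥ n, {p | p k = true} := by
      ext; simp
    rw [this]
    exact .iInter_of_isOpen fun n => isOpen_iUnion fun k => isOpen_iUnion fun _ =>
      isOpen_setOf_apply_eq k true
  have d2 : Dense {p : Cantor | ∀ n, ∃ k ≥ n, p k = true} :=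
    dense_of_exists_prefix fun p n => ⟨fun k => if k < n then p k else true,
      fun m => ⟨max m n, le_max_left _ _, by simp⟩, fun k hk => by simp [hk]⟩
  -- Baire: two dense `G_δ` sets meet.
  obtain ⟨p, hp1, hp2⟩ := (dense_countOnes_ne.inter_of_Gδ g1 g2 d2).nonempty
  exact hp1 (countOnes_eq_limitPoint_of_frequently hp2)

theorem not_piecewiseContinuous_countOnes : ¬ PiecewiseContinuous countOnes := by
  rintro ⟨A, hA, hcov, hcont⟩
  refine countOnes_fibre_ne_iUnion_isClosed (fun i => A i ∩ countOnes ⁻¹' {limitPoint})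
    (fun i => (hcont i).preimage_isClosed_of_isClosed (hA i) isClosed_singleton) ?_
  rw [← Set.iUnion_inter, hcov, Set.univ_inter]

theorem isOpen_openOf (r : Cantor) : IsOpen (openOf r) := by
  refine isOpen_iff_mem_nhds.2 fun p ⟨n, t, h⟩ => ?_
  have : ∀ᶠ q in 𝓝 p, ∀ k ∈ Finset.range n, q k = p k :=
    (Finset.eventually_all _).2 fun k _ => (isOpen_setOf_apply_eq k (p k)).mem_nhds rfl
  filter_upwards [this] with q hq
  exact ⟨n, t, by rwa [pre_congr fun k hk => hq k (Finset.mem_range.2 hk)]⟩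

theorem exists_openOf_eq_compl_singleton (a : Cantor) : ∃ r, openOf r = {a}ᶜ := by
  classical
  refine ⟨fun j => decide (wordOf j.unpair.1 ≠ pre a (wordOf j.unpair.1).length), ?_⟩
  ext p
  simp only [openOf, Set.mem_ofPred_eq, Nat.unpair_pair, wordOf_encode, length_pre,
    decide_eq_true_eq, Set.mem_compl_iff, Set.mem_singleton_iff]
  refine ⟨?_, fun h => ?_⟩
  · rintro ⟨n, -, h⟩ rfl
    exact h rfl
  · obtain ⟨k, hk⟩ := Function.ne_iff.1 h
    refine ⟨k + 1, 0, fun h' => hk ?_⟩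
    exact List.map_inj_left.1 h' k (by simp)

theorem not_effectivelyDelta2Measurable_countOnes : ¬ EffectivelyDelta2Measurable countOnes := by
  rintro ⟨F, -, hF⟩
  -- This name need not be computable, so the Markov condition does not cover it, whereas `F`
  -- accepts every name.
  obtain ⟨r, hr⟩ := exists_openOf_eq_compl_singleton limitPoint
  have h := (hF r).2
  refine countOnes_fibre_ne_iUnion_isClosed (fun i => (openOf (row (F r) (2 * i + 1)))ᶜ)
    (fun i => (isOpen_openOf _).isClosed_compl) ?_
  rw [← Set.compl_iInter, ← h, hr, Set.preimage_compl, compl_compl]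

end Delta2

theorem corollary17 :
    (∃ f : Delta2.Cantor → Delta2.Cantor,
      Delta2.MarkovEffectivelyDelta2Measurable f ∧ ¬ Delta2.PiecewiseContinuous f) ∧
    (∃ f : Delta2.Cantor → Delta2.Cantor,
      Delta2.MarkovEffectivelyDelta2Measurable f ∧ ¬ Delta2.EffectivelyDelta2Measurable f) :=
  ⟨⟨_, Delta2.markovEffectivelyDelta2Measurable_countOnes,
      Delta2.not_piecewiseContinuous_countOnes⟩,
    ⟨_, Delta2.markovEffectivelyDelta2Measurable_countOnes,
      Delta2.not_effectivelyDelta2Measurable_countOnes⟩⟩
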